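/- Let $p$ be a prime and let $G$ be a pro-$p$ group, that is, a compact, Hausdorff, totally disconnected topological group in which every open normal subgroup has index a power of $p$. Let $G'=\langle [x,g] : x,g\in G\rangle$ be the derived subgroup of $G$ (as an abstract group) and let $(G')^p$ be the subgroup generated by the $p$-th powers of the elements of $G'$. Suppose that $G'$, with the subspace topology, is topologically finitely generated, and write $d=\log_p|G':(G')^p|$. Suppose that $d\le p-1$ and that the action of $G$ on $G'$ is uniserial modulo $(G')^p$, that is, putting $\bar G=G/(G')^p$ and $N_0=G'/(G')^p$, $N_{i+1}=[N_i,\bar G]$, we have $|N_i:N_{i+1}|\le p$ for every $i\ge 0$. Then there exists $x\in G$ such that $G'=\{[x,g] : g\in G\}$. -/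

import Mathlib

open scoped commutatorElement

/-- `G` is a pro-`p` group: a profinite group (a compact, Hausdorff, totally disconnected
topological group) in which every open normal subgroup has index a power of `p`. -/
structure IsProPGroup (p : ℕ) (G : Type*) [Group G] [TopologicalSpace G] : Prop where
  isTopologicalGroup : IsTopologicalGroup G
  compactSpace : CompactSpace G
  t2Space : T2Space G
  totallyDisconnectedSpace : TotallyDisconnectedSpace G
  index_eq_pow : ∀ U : Subgroup G, U.Normal → IsOpen (U : Set G) → ∃ n : ℕ, U.index = p ^ n

/-- A topological group is topologically finitely generated if some finite subset generates a
dense subgroup. -/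
def IsTopologicallyFG (H : Type*) [Group H] [TopologicalSpace H] : Prop :=
  ∃ S : Set H, S.Finite ∧ Dense (Subgroup.closure S : Set H)

/-- `H ^ n`: the subgroup generated by the `n`-th powers of the elements of `H`. -/
def powSubgroup {G : Type*} [Group G] (H : Subgroup G) (n : ℕ) : Subgroup G :=
  Subgroup.closure {y : G | ∃ h ∈ H, h ^ n = y}

instance powSubgroup_normal {G : Type*} [Group G] (H : Subgroup G) [hH : H.Normal] (n : ℕ) :
    (powSubgroup H n).Normal := by
  have key : ∀ s ∈ {y : G | ∃ h ∈ H, h ^ n = y}, ∀ g : G,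
      g * s * g⁻¹ ∈ {y : G | ∃ h ∈ H, h ^ n = y} := by
    rintro _ ⟨h, hh, rfl⟩ g
    exact ⟨g * h * g⁻¹, hH.conj_mem h hh g, conj_pow⟩
  refine ⟨fun a ha g => ?_⟩
  have hle : powSubgroup H n ≤ (powSubgroup H n).comap (MulAut.conj g).toMonoidHom := by
    refine (Subgroup.closure_le _).2 fun s hs => ?_
    exact Subgroup.subset_closure (key s hs g)
  exact hle ha

/-- `[N, G, …, G]` with `i` copies of `G`. -/
def iteratedCommutator {G : Type*} [Group G] (N : Subgroup G) : ℕ → Subgroup G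
  | 0 => N
  | i + 1 => ⁅iteratedCommutator N i, (⊤ : Subgroup G)⁆

/-- The action of `G` on its normal subgroup `N` is uniserial: each index
`|[N, G, …, G] : [N, G, …, G]|` (`i` and `i + 1` copies of `G`) is finite and at most `p`.
The first conjunct says that the index is finite. -/
def ActsUniserially {G : Type*} [Group G] (p : ℕ) (N : Subgroup G) : Prop :=
  ∀ i : ℕ, (iteratedCommutator N (i + 1)).relIndex (iteratedCommutator N i) ≠ 0 ∧
    (iteratedCommutator N (i + 1)).relIndex (iteratedCommutator N i) ≤ p

/-- The action of `G` on `N` is uniserial modulo `K`: the action of `G ⧸ K` on the image of `N`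
is uniserial. -/
def ActsUniseriallyModulo {G : Type*} [Group G] (p : ℕ) (N K : Subgroup G) [K.Normal] : Prop :=
  ActsUniserially p (N.map (QuotientGroup.mk' K))

/-!
By compactness it suffices to find `x` in every finite continuous quotient of `G`
(`exists_forall_mem_commutator_of_quotients`), so let `G` be a finite `p`-group. If `G'` is not
trivial, let `N 0 > N 1 > ⋯ > N d` be the series `N i = [G', G, …, G] (G') ^ p`, with `i` copies of
`G`, down to `N d = (G') ^ p`. By assumption its factors have order `p`, and `d ≤ p - 1`. Continue it
by `N (i + d) = (N i) ^ p` until it reaches the trivial subgroup (`IsUniserialPowerSeries`).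

The engine is a weak form of the Hall–Petrescu formula (`mul_pow_prime_mem`): `p`-th powers are
multiplicative modulo `p`-th powers of commutators and commutators of length `p`. It is proved with
polynomial sequences in a filtered group: `n ↦ (a b) ^ n b ^ (-n) a ^ (-n)` is such a sequence,
trivial at `0` and `1`, hence its value at `p` is a product of powers with exponents
`p.choose i`, `2 ≤ i ≤ p`. Since `N i ≤ G'`, a commutator with `N i` moves down the series by two
steps, so `d ≤ p - 1` makes commutators of length `p` negligible. Consequently all factors of the
series are central (`commutator_le_succ`) and cyclic of order dividing `p`, and the `p`-th power map
carries generators of `N i / N (i + 1)` to generators of `N (i + d) / N (i + d + 1)`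
(`le_zpowers_pow_sup`). Moreover `[x, h ^ p] ≡ [x, h] ^ p` modulo `N (i + d + 1)` if `[x, h] ∈ N i`
and `h ∈ G'`, or if `h` is arbitrary and `[N (i + d - 1), G] ≤ N (i + d + 1)`.

The element `x` is chosen outside the centralizers of `G / N 1`, of the sections
`N i / N (i + 2)` for `i ≤ d - 2`, and of `N (d - 1) / N (d + 1)` if this is not central. These
are at most `d + 1 ≤ p` proper subgroups, which cannot cover a `p`-group. For this `x`, every
non-trivial factor `N j / N (j + 1)` contains a non-trivial class of a commutator `[x, h]`: for small
`j` by the choice of `x`, and then by taking `p`-th powers of `h`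
(`exists_commutator_mem_notMem`). As the factors are central of order `p`, commutators with `x` fill
each of them, and successive approximation along the series writes every element of `G'` as
`[x, g]`.
-/

/-! ### Polynomial sequences and the Hall–Petrescu congruence -/

/-- The multiplicative difference `n ↦ (f n)⁻¹ f (n + 1)` of a sequence in a group. -/
def mulDiff {G : Type*} [Group G] (f : ℕ → G) : ℕ → G := fun n => (f n)⁻¹ * f (n + 1)

/-- `IsPolySeq F m k f`: for every `j ≤ m` the `j`-th multiplicative difference of `f` takes its
values in `F (k + j)`. For a filtration `F` these are the polynomial sequences of Lazard and
Leibman, with differences controlled only up to order `m`, so that closure properties can be proved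
by induction on `m`. -/
def IsPolySeq {G : Type*} [Group G] (F : ℕ → Subgroup G) : ℕ → ℕ → (ℕ → G) → Prop
  | 0, k, f => ∀ n, f n ∈ F k
  | m + 1, k, f => (∀ n, f n ∈ F k) ∧ IsPolySeq F m (k + 1) (mulDiff f)

section PolySeq

variable {G : Type*} [Group G] {F : ℕ → Subgroup G}

theorem IsPolySeq.of_succ {m k : ℕ} {f : ℕ → G} (h : IsPolySeq F (m + 1) k f) :
    IsPolySeq F m k f := by
  induction m generalizing k f with
  | zero => exact h.1
  | succ m ih => exact ⟨h.1, ih h.2⟩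

theorem IsPolySeq.of_le (hF : Antitone F) {m j k : ℕ} (hjk : j ≤ k) {f : ℕ → G}
    (h : IsPolySeq F m k f) : IsPolySeq F m j f := by
  induction m generalizing j k f with
  | zero => exact fun n => hF hjk (h n)
  | succ m ih => exact ⟨fun n => hF hjk (h.1 n), ih (Nat.succ_le_succ hjk) h.2⟩

theorem isPolySeq_one (m k : ℕ) : IsPolySeq F m k (1 : ℕ → G) := by
  induction m generalizing k with
  | zero => exact fun n => one_mem _
  | succ m ih =>
    refine ⟨fun n => one_mem _, ?_⟩
    have : mulDiff (1 : ℕ → G) = 1 := by funext n; simp [mulDiff]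
    rw [this]
    exact ih _

/-- Polynomial sequences are closed under products, inverses and commutators. The three statements
are proved together, since the differences of these sequences involve products, inverses
and commutators of the given sequences and their differences. -/
theorem IsPolySeq.closure (hF : Antitone F) (hc : ∀ i j, ⁅F i, F j⁆ ≤ F (i + j)) (m : ℕ) :
    (∀ k f g, IsPolySeq F m k f → IsPolySeq F m k g → IsPolySeq F m k (f * g)) ∧
    (∀ k f, IsPolySeq F m k f → IsPolySeq F m k f⁻¹) ∧
    (∀ j k f g, IsPolySeq F m j f → IsPolySeq F m k g → IsPolySeq F m (j + k) ⁅f, g⁆) := by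
  induction m with
  | zero =>
    exact ⟨fun k f g hf hg n => mul_mem (hf n) (hg n), fun k f hf n => inv_mem (hf n),
      fun j k f g hf hg n => hc j k (Subgroup.commutator_mem_commutator (hf n) (hg n))⟩
  | succ m ih =>
    obtain ⟨hmul, hinv, hcomm⟩ := ih
    have hconj : ∀ j k f g, IsPolySeq F m j f → IsPolySeq F m k g →
        IsPolySeq F m k (f * g * f⁻¹) := by
      intro j k f g hf hg
      have : f * g * f⁻¹ = ⁅f, g⁆ * g := by simp [commutatorElement_def]
      rw [this]
      exact hmul _ _ _ ((hcomm _ _ _ _ hf hg).of_le hF (Nat.le_add_left _ _)) hg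
    refine ⟨fun k f g hf hg => ⟨fun n => mul_mem (hf.1 n) (hg.1 n), ?_⟩,
      fun k f hf => ⟨fun n => inv_mem (hf.1 n), ?_⟩,
      fun j k f g hf hg =>
        ⟨fun n => hc j k (Subgroup.commutator_mem_commutator (hf.1 n) (hg.1 n)), ?_⟩⟩
    · have : mulDiff (f * g) = g⁻¹ * mulDiff f * g⁻¹⁻¹ * mulDiff g := by
        funext n; simp [mulDiff, mul_assoc]
      rw [this]
      exact hmul _ _ _ (hconj _ _ _ _ (hinv _ _ hg.of_succ) hf.2) hg.2
    · have : mulDiff f⁻¹ = f * (mulDiff f)⁻¹ * f⁻¹ := by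
        funext n; simp [mulDiff, mul_assoc]
      rw [this]
      exact hconj _ _ _ _ hf.of_succ (hinv _ _ hf.2)
    · have hfs := hf.of_succ
      have hgs := hg.of_succ
      have hnext : mulDiff ⁅f, g⁆ =
          ⁅f, g⁆⁻¹ * (f * ⁅mulDiff f, g * mulDiff g⁆ * f⁻¹) * ⁅f, g⁆⁻¹⁻¹ *
            (g * ⁅f, mulDiff g⁆ * g⁻¹) := by
        funext n; simp [mulDiff, commutatorElement_def, mul_assoc]
      have hgg : IsPolySeq F m k (g * mulDiff g) :=
        hmul _ _ _ hgs (hg.2.of_le hF (Nat.le_succ k))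
      have h1 : IsPolySeq F m (j + k + 1) ⁅mulDiff f, g * mulDiff g⁆ := by
        have := hcomm _ _ _ _ hf.2 hgg
        rwa [Nat.add_right_comm] at this
      have h2 : IsPolySeq F m (j + k + 1) ⁅f, mulDiff g⁆ := hcomm j (k + 1) _ _ hfs hg.2
      rw [hnext]
      exact hmul _ _ _ (hconj _ _ _ _ (hinv _ _ (hcomm _ _ _ _ hfs hgs))
        (hconj _ _ _ _ hfs h1)) (hconj _ _ _ _ hgs h2)

theorem isPolySeq_pow_choose (hF : Antitone F) {k i : ℕ} {a : G} (ha : a ∈ F (k + i)) (m : ℕ) :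
    IsPolySeq F m k (fun n => a ^ n.choose i) := by
  induction m generalizing k i with
  | zero => exact fun n => pow_mem (hF (Nat.le_add_right k i) ha) _
  | succ m ih =>
    refine ⟨fun n => pow_mem (hF (Nat.le_add_right k i) ha) _, ?_⟩
    cases i with
    | zero =>
      have : mulDiff (fun n => a ^ n.choose 0) = 1 := by funext n; simp [mulDiff]
      rw [this]
      exact isPolySeq_one _ _
    | succ i =>
      have : mulDiff (fun n => a ^ n.choose (i + 1)) = fun n => a ^ n.choose i := by
        funext n
        simp [mulDiff, Nat.choose_succ_succ, add_comm (n.choose i), pow_add]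
      rw [this]
      exact ih (by rwa [Nat.add_right_comm, Nat.add_assoc])

/-- A polynomial sequence which is trivial at `0, …, m - 1` takes at `m` the value of its `m`-th
difference at `0`. -/
theorem IsPolySeq.apply_mem {m k : ℕ} {f : ℕ → G} (h : IsPolySeq F m k f)
    (h1 : ∀ n < m, f n = 1) : f m ∈ F (k + m) := by
  induction m generalizing k f with
  | zero => exact h 0
  | succ m ih =>
    have h2 := ih h.2 fun n hn => by
      simp [mulDiff, h1 n (by omega), h1 (n + 1) (by omega)]
    rwa [mulDiff, h1 m (by omega), inv_one, one_mul, Nat.add_right_comm, Nat.add_assoc] at h2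

/-- The value at `p` of a polynomial sequence trivial at `0` and `1` is, up to a factor in `F p`, a
product of powers `a ^ p.choose i` with `2 ≤ i < p` and `a ∈ F i`. -/
theorem IsPolySeq.apply_prime_mem {p : ℕ} (hp : p.Prime) (hF : Antitone F)
    (hc : ∀ i j, ⁅F i, F j⁆ ≤ F (i + j)) {T : Subgroup G} (hT : F p ≤ T)
    (hpow : ∀ z ∈ F 2, z ^ p ∈ T) {i : ℕ} (hi : 2 ≤ i) (hip : i ≤ p) {f : ℕ → G}
    (hf : ∀ m, IsPolySeq F m 0 f) (h1 : ∀ n < i, f n = 1) : f p ∈ T := by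
  induction hip using Nat.decreasingInduction generalizing f with
  | self =>
    have := (hf p).apply_mem h1
    rw [zero_add] at this
    exact hT this
  | of_succ i hip ih =>
    have ha : f i ∈ F (0 + i) := (hf i).apply_mem h1
    have hcl := IsPolySeq.closure hF hc
    have key := ih (by omega) (f := (fun n => f i ^ n.choose i)⁻¹ * f)
      (fun m => (hcl m).1 _ _ _ ((hcl m).2.1 _ _ (isPolySeq_pow_choose hF ha m)) (hf m))
      (fun n hn => by
        rcases Nat.lt_succ_iff_lt_or_eq.1 hn with hn | rfl
        · simp [h1 n hn, Nat.choose_eq_zero_of_lt hn]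
        · simp)
    obtain ⟨c, hc'⟩ := hp.dvd_choose_self (by omega : i ≠ 0) hip
    rw [zero_add] at ha
    have h2 : f i ^ p.choose i ∈ T := by
      rw [hc', mul_comm, pow_mul]
      exact hpow _ (pow_mem (hF hi ha) c)
    have h3 := mul_mem h2 key
    simpa using h3

/-- A form of the Hall–Petrescu formula: for a filtration `F` of a group and a prime `p`, taking
`p`-th powers is multiplicative on `F 1` modulo any subgroup which contains `F p` and the `p`-th
powers of the elements of `F 2`. -/
theorem mul_pow_prime_mem {p : ℕ} (hp : p.Prime) (hF : Antitone F)
    (hc : ∀ i j, ⁅F i, F j⁆ ≤ F (i + j)) {T : Subgroup G} (hT : F p ≤ T)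
    (hpow : ∀ z ∈ F 2, z ^ p ∈ T) {a b : G} (ha : a ∈ F 1) (hb : b ∈ F 1) :
    (a * b) ^ p * (b ^ p)⁻¹ * (a ^ p)⁻¹ ∈ T := by
  have hcl := IsPolySeq.closure hF hc
  have hlin : ∀ c ∈ F 1, ∀ m, IsPolySeq F m 0 (fun n => c ^ n) := by
    intro c hcm m
    simpa using isPolySeq_pow_choose (k := 0) (i := 1) hF hcm m
  refine IsPolySeq.apply_prime_mem (i := 2) hp hF hc hT hpow le_rfl hp.two_le
    (f := (fun n => (a * b) ^ n) * (fun n => b ^ n)⁻¹ * (fun n => a ^ n)⁻¹) (fun m => ?_) ?_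
  · exact (hcl m).1 _ _ _ ((hcl m).1 _ _ _ (hlin _ (mul_mem ha hb) m)
      ((hcl m).2.1 _ _ (hlin b hb m))) ((hcl m).2.1 _ _ (hlin a ha m))
  · intro n hn
    interval_cases n <;> simp

end PolySeq

/-! ### Commutators of normal subgroups -/

/-- The subgroup `[A, B, …, B]` with `k` copies of `B`. -/
def mixedCommutator {G : Type*} [Group G] (A B : Subgroup G) : ℕ → Subgroup G
  | 0 => A
  | k + 1 => ⁅mixedCommutator A B k, B⁆

section MixedCommutator

variable {G : Type*} [Group G]

instance mixedCommutator_normal (A B : Subgroup G) [A.Normal] [B.Normal] (k : ℕ) :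
    (mixedCommutator A B k).Normal := by
  induction k with
  | zero => assumption
  | succ k ih => exact Subgroup.commutator_normal _ _

theorem mixedCommutator_mono {A A' B B' : Subgroup G} (hA : A ≤ A') (hB : B ≤ B') (k : ℕ) :
    mixedCommutator A B k ≤ mixedCommutator A' B' k := by
  induction k with
  | zero => exact hA
  | succ k ih => exact Subgroup.commutator_mono ih hB

theorem mixedCommutator_antitone (A B : Subgroup G) [A.Normal] [B.Normal] :
    Antitone (mixedCommutator A B) :=
  antitone_nat_of_succ_le fun _ => Subgroup.commutator_le_left _ _

/-- The three subgroups lemma modulo a normal subgroup. -/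
theorem commutator_commutator_le_of_rotate {A B C T : Subgroup G} [T.Normal]
    (h1 : ⁅⁅B, C⁆, A⁆ ≤ T) (h2 : ⁅⁅C, A⁆, B⁆ ≤ T) : ⁅⁅A, B⁆, C⁆ ≤ T := by
  have key : ∀ X : Subgroup G, X ≤ T ↔ X.map (QuotientGroup.mk' T) = ⊥ := fun X => by
    rw [Subgroup.map_eq_bot_iff, QuotientGroup.ker_mk']
  rw [key] at h1 h2 ⊢
  simp only [Subgroup.map_commutator] at h1 h2 ⊢
  exact Subgroup.commutator_commutator_eq_bot_of_rotate h1 h2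

theorem commutator_mixedCommutator_le (A B : Subgroup G) [A.Normal] [B.Normal] (i j : ℕ) :
    ⁅mixedCommutator A B i, mixedCommutator B B j⁆ ≤ mixedCommutator A B (i + j + 1) := by
  induction j generalizing i with
  | zero => exact le_rfl
  | succ j ih =>
    rw [Subgroup.commutator_comm]
    refine commutator_commutator_le_of_rotate ?_ ?_
    · rw [Subgroup.commutator_comm B]
      have := ih (i + 1)
      rwa [show i + 1 + j + 1 = i + (j + 1) + 1 by omega] at this
    · exact Subgroup.commutator_mono (ih i) le_rfl

theorem commutator_commutator_top_le (A : Subgroup G) [A.Normal] :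
    ⁅A, commutator G⁆ ≤ ⁅⁅A, (⊤ : Subgroup G)⁆, (⊤ : Subgroup G)⁆ := by
  rw [Subgroup.commutator_comm, commutator_def]
  refine commutator_commutator_le_of_rotate ?_ le_rfl
  rw [Subgroup.commutator_comm ⊤ A]

/-- A commutator with an element of the derived subgroup counts as two commutators. -/
theorem mixedCommutator_le_of_le_commutator (A B : Subgroup G) [A.Normal] [B.Normal]
    (hB : B ≤ commutator G) (k : ℕ) : mixedCommutator A B k ≤ mixedCommutator A ⊤ (2 * k) := by
  induction k with
  | zero => exact le_rfl
  | succ k ih =>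
    exact (Subgroup.commutator_mono ih hB).trans (commutator_commutator_top_le _)

theorem mem_commutator_of_mem_zpowers_sup {A B : Subgroup G} [A.Normal] [B.Normal] (hAB : A ≤ B)
    {b : G} (hb : b ∈ B) {x y : G} (hx : x ∈ Subgroup.zpowers b ⊔ A)
    (hy : y ∈ Subgroup.zpowers b ⊔ A) : ⁅x, y⁆ ∈ ⁅A, B⁆ := by
  have hN : (⁅A, B⁆ : Subgroup G).Normal := Subgroup.commutator_normal _ _
  have hle : Subgroup.zpowers b ⊔ A ≤ B := sup_le (by simpa using hb) hAB
  have hyB := hle hy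
  obtain ⟨u, hu, a, ha, rfl⟩ := Subgroup.mem_sup_of_normal_right.1 hx
  obtain ⟨v, hv, c, hcA, rfl⟩ := Subgroup.mem_sup_of_normal_right.1 hy
  have huB : u ∈ B := hle (Subgroup.mem_sup_left hu)
  obtain ⟨m, rfl⟩ := Subgroup.mem_zpowers_iff.1 hu
  obtain ⟨n, rfl⟩ := Subgroup.mem_zpowers_iff.1 hv
  have hcom : ⁅b ^ m, b ^ n⁆ = 1 :=
    commutatorElement_eq_one_iff_commute.2 ((Commute.refl b).zpow_zpow m n)
  rw [commutatorElement_mul_left_eq_conj_mul, commutatorElement_mul_right_eq_mul_conj (b ^ m), hcom,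
    one_mul]
  refine mul_mem (hN.conj_mem _ (Subgroup.commutator_mem_commutator ha hyB) _)
    (hN.conj_mem _ ?_ _)
  rw [← commutatorElement_inv]
  exact inv_mem (Subgroup.commutator_mem_commutator hcA huB)

/-- The Hall–Petrescu congruence for the filtration `⟨b⟩ A`, `[A, B]`, `[A, B, B]`, …. -/
theorem mul_pow_prime_mem_of_normal {p : ℕ} (hp : p.Prime) {A B T : Subgroup G} [A.Normal]
    [B.Normal] (hAB : A ≤ B) (hT : mixedCommutator A B (p - 1) ≤ T)
    (hpow : ∀ z ∈ ⁅A, B⁆, z ^ p ∈ T) {a b : G} (ha : a ∈ A) (hb : b ∈ B) :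
    (a * b) ^ p * (b ^ p)⁻¹ * (a ^ p)⁻¹ ∈ T := by
  have hle : Subgroup.zpowers b ⊔ A ≤ B := sup_le (by simpa using hb) hAB
  let F : ℕ → Subgroup G := fun k => if k < 2 then Subgroup.zpowers b ⊔ A
    else mixedCommutator A B (k - 1)
  have F0 : ∀ k < 2, F k = Subgroup.zpowers b ⊔ A := fun k hk => if_pos hk
  have F2 : ∀ k, F (k + 2) = mixedCommutator A B (k + 1) := fun k => if_neg (by omega)
  have hF : Antitone F := by
    refine antitone_nat_of_succ_le fun k => ?_
    rcases k with _ | _ | k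
    · exact le_rfl
    · exact (Subgroup.commutator_le_left A B).trans le_sup_right
    · exact Subgroup.commutator_le_left (mixedCommutator A B (k + 1)) B
  have h02 : ∀ i < 2, ∀ j, ⁅F i, F (j + 2)⁆ ≤ F (i + (j + 2)) := by
    intro i hi j
    have h1 : ⁅F i, F (j + 2)⁆ ≤ F (j + 1 + 2) := by
      rw [F0 i hi, F2, F2, Subgroup.commutator_comm]
      exact Subgroup.commutator_mono le_rfl hle
    exact h1.trans (hF (by omega))
  have hc : ∀ i j, ⁅F i, F j⁆ ≤ F (i + j) := by
    intro i j
    by_cases hi : i < 2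
    · by_cases hj : j < 2
      · have h1 : ⁅F i, F j⁆ ≤ F (0 + 2) := by
          rw [F0 i hi, F0 j hj, F2, Subgroup.commutator_le]
          exact fun x hx y hy => mem_commutator_of_mem_zpowers_sup hAB hb hx hy
        exact h1.trans (hF (by omega))
      · obtain ⟨j, rfl⟩ := Nat.exists_eq_add_of_le' (not_lt.1 hj)
        exact h02 i hi j
    · obtain ⟨i, rfl⟩ := Nat.exists_eq_add_of_le' (not_lt.1 hi)
      by_cases hj : j < 2
      · rw [Subgroup.commutator_comm, add_comm (i + 2)]
        exact h02 j hj i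
      · obtain ⟨j, rfl⟩ := Nat.exists_eq_add_of_le' (not_lt.1 hj)
        rw [F2, F2, show i + 2 + (j + 2) = i + j + 2 + 2 by omega, F2]
        refine (Subgroup.commutator_mono le_rfl (mixedCommutator_mono hAB le_rfl (j + 1))).trans ?_
        have := commutator_mixedCommutator_le A B (i + 1) (j + 1)
        rwa [show i + 1 + (j + 1) + 1 = i + j + 2 + 1 by omega] at this
  have hFp : F p ≤ T := by
    have h2 := hp.two_le
    have : F p = mixedCommutator A B (p - 1) := if_neg (by omega)
    rwa [this]
  exact mul_pow_prime_mem hp hF hc hFp hpow (Subgroup.mem_sup_right ha)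
    (Subgroup.mem_sup_left (Subgroup.mem_zpowers b))

/-- A subgroup `A` of a nilpotent group is contained in the normal subgroup `M` as soon as it is
contained in `M [A, G]`. -/
theorem le_of_le_sup_commutator_top [Group.IsNilpotent G] {A M : Subgroup G} [M.Normal]
    (h : A ≤ M ⊔ ⁅A, (⊤ : Subgroup G)⁆) : A ≤ M := by
  have h1 : ∀ k, A ≤ M ⊔ mixedCommutator A ⊤ k := by
    intro k
    induction k with
    | zero => exact le_sup_right
    | succ k ih =>
      refine h.trans (sup_le le_sup_left ?_)
      rw [Subgroup.commutator_le]
      intro x hx g _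
      obtain ⟨m, hm, c, hcm, rfl⟩ := Subgroup.mem_sup_of_normal_left.1 (ih hx)
      rw [commutatorElement_mul_left_eq_conj_mul]
      have h2 : ⁅m, g⁆ ∈ M :=
        Subgroup.commutator_le_left M ⊤ (Subgroup.commutator_mem_commutator hm trivial)
      have h3 : ⁅c, g⁆ ∈ mixedCommutator A ⊤ (k + 1) :=
        Subgroup.commutator_mem_commutator hcm trivial
      have h4 : m * ⁅c, g⁆ * m⁻¹ = m * (⁅c, g⁆ * m⁻¹ * ⁅c, g⁆⁻¹) * ⁅c, g⁆ := by group
      rw [h4]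
      exact mul_mem (mul_mem (Subgroup.mem_sup_left hm)
        (Subgroup.mem_sup_left (Subgroup.Normal.conj_mem ‹_› _ (inv_mem hm) _))
        |> fun h => mul_mem h (Subgroup.mem_sup_right h3)) (Subgroup.mem_sup_left h2)
  obtain ⟨n, hn⟩ := Subgroup.nilpotent_iff_lowerCentralSeries.1 ‹Group.IsNilpotent G›
  have h2 : ∀ k, mixedCommutator A ⊤ k ≤ (⊤ : Subgroup G).lowerCentralSeries k := by
    intro k
    induction k with
    | zero => exact le_top
    | succ k ih => exact Subgroup.commutator_mono ih le_rfl
  have h3 := h2 n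
  rw [hn, le_bot_iff] at h3
  simpa [h3] using h1 n

end MixedCommutator

/-! ### Finite `p`-groups -/

section PGroup

variable {G : Type*} [Group G]

theorem pow_mem_powSubgroup {H : Subgroup G} {h : G} (hh : h ∈ H) (n : ℕ) :
    h ^ n ∈ powSubgroup H n :=
  Subgroup.subset_closure ⟨h, hh, rfl⟩

theorem powSubgroup_le_iff {H K : Subgroup G} {n : ℕ} :
    powSubgroup H n ≤ K ↔ ∀ h ∈ H, h ^ n ∈ K := by
  rw [powSubgroup, Subgroup.closure_le]
  exact ⟨fun h x hx => h ⟨x, hx, rfl⟩, fun h => by rintro _ ⟨x, hx, rfl⟩; exact h x hx⟩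

theorem powSubgroup_mono {H K : Subgroup G} (h : H ≤ K) (n : ℕ) :
    powSubgroup H n ≤ powSubgroup K n :=
  powSubgroup_le_iff.2 fun _ hx => pow_mem_powSubgroup (h hx) n

theorem powSubgroup_le (H : Subgroup G) (n : ℕ) : powSubgroup H n ≤ H :=
  powSubgroup_le_iff.2 fun _ hx => pow_mem hx n

theorem map_powSubgroup {Q : Type*} [Group Q] (f : G →* Q) (H : Subgroup G) (n : ℕ) :
    (powSubgroup H n).map f = powSubgroup (H.map f) n := by
  apply le_antisymm
  · rw [Subgroup.map_le_iff_le_comap, powSubgroup_le_iff]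
    intro h hh
    rw [Subgroup.mem_comap, map_pow]
    exact pow_mem_powSubgroup (Subgroup.mem_map_of_mem f hh) n
  · rw [powSubgroup_le_iff]
    rintro _ ⟨h, hh, rfl⟩
    rw [← map_pow]
    exact Subgroup.mem_map_of_mem f (pow_mem_powSubgroup hh n)

/-- A finite `p`-group which is generated by its `p`-th powers is trivial, since its abelianization
is. -/
theorem eq_bot_of_le_powSubgroup [Finite G] {p : ℕ} [hp : Fact p.Prime] (hG : IsPGroup p G)
    {H : Subgroup G} (h : H ≤ powSubgroup H p) : H = ⊥ := by
  by_contra hne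
  have : Nontrivial H := (Subgroup.nontrivial_iff_ne_bot H).2 hne
  have hH : IsPGroup p H := hG.to_subgroup H
  have : Group.IsNilpotent H := hH.isNilpotent
  have hlt := Group.IsSolvable.commutator_lt_top_of_nontrivial H
  have : Nontrivial (Abelianization H) :=
    (QuotientGroup.nontrivial_iff (N := commutator H)).2 hlt.ne
  have hA : IsPGroup p (Abelianization H) := hH.to_quotient _
  have hrange : ∀ x ∈ powSubgroup H p, ∀ hx : x ∈ H,
      Abelianization.of (⟨x, hx⟩ : H) ∈ (powMonoidHom p : Abelianization H →* _).range := by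
    have : powSubgroup H p ≤
        (((powMonoidHom p : Abelianization H →* _).range).comap Abelianization.of).map
          H.subtype := by
      rw [powSubgroup_le_iff]
      exact fun x hx => ⟨⟨x, hx⟩ ^ p, ⟨Abelianization.of ⟨x, hx⟩, (map_pow _ _ _).symm⟩, rfl⟩
    rintro x hxp hx
    obtain ⟨y, hy, rfl⟩ := this hxp
    exact hy
  have hsurj : Function.Surjective (powMonoidHom p : Abelianization H →* Abelianization H) := by
    intro a
    obtain ⟨⟨x, hx⟩, rfl⟩ := QuotientGroup.mk_surjective a
    exact hrange x (h hx) hx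
  have hinj := Finite.injective_iff_surjective.2 hsurj
  obtain ⟨a, ha⟩ := exists_ne (1 : Abelianization H)
  obtain ⟨b, hb⟩ := exists_prime_orderOf_dvd_card' (G := Abelianization H) p (by
    obtain ⟨n, hn⟩ := IsPGroup.iff_card.1 hA
    rw [hn]
    refine dvd_pow_self p ?_
    rintro rfl
    rw [pow_zero, Nat.card_eq_one_iff_unique] at hn
    exact ha (hn.1.elim _ _))
  have hb1 : b = 1 := hinj (by simp [powMonoidHom_apply, ← hb, pow_orderOf_eq_one])
  rw [hb1, orderOf_one] at hb
  exact hp.out.one_lt.ne hb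

/-- In a `p`-group, `p` proper subgroups never cover the group: each of them has at most
`|G| / p` elements, and they share the identity. -/
theorem exists_notMem_of_card_le [Finite G] {p : ℕ} [hp : Fact p.Prime] (hG : IsPGroup p G)
    {ι : Type*} (s : Finset ι) (hs : s.card ≤ p) (H : ι → Subgroup G) (hH : ∀ i ∈ s, H i ≠ ⊤) :
    ∃ x, ∀ i ∈ s, x ∉ H i := by
  classical
  have := Fintype.ofFinite G
  by_contra! hcov
  obtain ⟨n, hn⟩ := IsPGroup.iff_card.1 hG
  have hcard : ∀ i ∈ s, p * Nat.card (H i) ≤ Nat.card G := by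
    intro i hi
    have h1 : (H i).index ∣ p ^ n := hn ▸ (H i).index_dvd_card
    obtain ⟨m, -, hm⟩ := (Nat.dvd_prime_pow hp.out).1 h1
    have hm0 : m ≠ 0 := by
      rintro rfl
      exact hH i hi (Subgroup.index_eq_one.1 (by simpa using hm))
    rw [← (H i).card_mul_index, mul_comm]
    refine Nat.mul_le_mul_left _ ?_
    rw [hm]
    exact Nat.le_self_pow hm0 p
  have hsub : (Finset.univ : Finset G).erase 1 ⊆
      s.biUnion fun i => (Finset.univ.filter fun x => x ∈ H i).erase 1 := by
    intro x hx
    obtain ⟨i, hi, hxi⟩ := hcov x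
    exact Finset.mem_biUnion.2 ⟨i, hi, Finset.mem_erase.2
      ⟨(Finset.mem_erase.1 hx).1, by simpa using hxi⟩⟩
  have h1 := (Finset.card_le_card hsub).trans Finset.card_biUnion_le
  have h2 : ∀ i ∈ s, p * ((Finset.univ.filter fun x => x ∈ H i).erase 1).card ≤
      Nat.card G - p := by
    intro i hi
    have h3 : (Finset.univ.filter fun x => x ∈ H i).card = Nat.card (H i) := by
      rw [Nat.card_eq_fintype_card, Fintype.card_subtype]
    rw [Finset.card_erase_of_mem (by simp), h3, Nat.mul_sub, mul_one]
    exact Nat.sub_le_sub_right (hcard i hi) p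
  rw [Finset.card_erase_of_mem (Finset.mem_univ _), Finset.card_univ,
    ← Nat.card_eq_fintype_card] at h1
  have h4 := Finset.sum_le_card_nsmul s _ _ h2
  rw [← Finset.mul_sum, smul_eq_mul] at h4
  have h5 : p * (Nat.card G - 1) ≤ p * (Nat.card G - p) :=
    (Nat.mul_le_mul_left p h1).trans (h4.trans (Nat.mul_le_mul_right _ hs))
  have h6 := Nat.le_of_mul_le_mul_left h5 hp.out.pos
  have h7 := hp.out.two_le
  obtain ⟨i, hi, -⟩ := hcov 1
  have h8 := hcard i hi
  have h9 : 0 < Nat.card (H i) := Nat.card_pos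
  have h10 : p ≤ Nat.card G := le_trans (Nat.le_mul_of_pos_right p h9) h8
  omega

end PGroup

/-! ### Avoiding centralizers, and commutators with powers -/

section Commutators

variable {G : Type*} [Group G]

/-- A finite `p`-group has an element `x` which acts as non-trivially as possible on `p` given
sections: whenever `[E, G] ≰ M`, already `x` satisfies `[x, E] ≰ M`. -/
theorem exists_commutator_notMem [Finite G] {p : ℕ} [Fact p.Prime] (hG : IsPGroup p G)
    (E M : ℕ → Subgroup G) [∀ i, (M i).Normal] :
    ∃ x : G, ∀ i < p, ⁅E i, (⊤ : Subgroup G)⁆ ≤ M i ∨ ∃ h ∈ E i, ⁅x, h⁆ ∉ M i := by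
  classical
  let C : ℕ → Subgroup G := fun i =>
    (Subgroup.centralizer ((E i).map (QuotientGroup.mk' (M i)) : Set (G ⧸ M i))).comap
      (QuotientGroup.mk' (M i))
  have hC : ∀ i x, x ∈ C i ↔ ∀ h ∈ E i, ⁅x, h⁆ ∈ M i := by
    intro i x
    simp only [C, Subgroup.mem_comap, Subgroup.mem_centralizer_iff_commutator_eq_one]
    constructor
    · intro hx h hh
      have := hx _ (Subgroup.mem_map_of_mem _ hh)
      rw [← map_commutatorElement] at this
      rw [← commutatorElement_inv]
      exact inv_mem ((QuotientGroup.eq_one_iff _).1 this)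
    · rintro hx _ ⟨h, hh, rfl⟩
      rw [← map_commutatorElement]
      refine (QuotientGroup.eq_one_iff _).2 ?_
      rw [← commutatorElement_inv]
      exact inv_mem (hx h hh)
  obtain ⟨x, hx⟩ := exists_notMem_of_card_le hG
    ((Finset.range p).filter fun i => ¬ ⁅E i, (⊤ : Subgroup G)⁆ ≤ M i)
    ((Finset.card_filter_le _ _).trans (Finset.card_range p).le) C (by
      intro i hi htop
      refine (Finset.mem_filter.1 hi).2 ?_
      rw [Subgroup.commutator_le]
      intro h hh g _
      have hg : g ∈ C i := htop ▸ Subgroup.mem_top g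
      rw [← commutatorElement_inv]
      exact inv_mem ((hC i g).1 hg h hh))
  refine ⟨x, fun i hi => ?_⟩
  by_cases h : ⁅E i, (⊤ : Subgroup G)⁆ ≤ M i
  · exact Or.inl h
  · have := hx i (Finset.mem_filter.2 ⟨Finset.mem_range.2 hi, h⟩)
    rw [hC] at this
    push Not at this
    exact Or.inr this

/-- The congruence `[g, n ^ p] ≡ [g, n] ^ p`. -/
theorem commutator_pow_prime_mem {p : ℕ} (hp : p.Prime) {A B T : Subgroup G} [A.Normal]
    [B.Normal] (hAB : A ≤ B) (hT : mixedCommutator A B (p - 1) ≤ T)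
    (hpow : ∀ z ∈ ⁅A, B⁆, z ^ p ∈ T) {g n : G} (hgn : ⁅g, n⁆ ∈ A) (hn : n ∈ B) :
    ⁅g, n ^ p⁆ * (⁅g, n⁆ ^ p)⁻¹ ∈ T := by
  have h := mul_pow_prime_mem_of_normal hp hAB hT hpow hgn hn
  have h1 : ⁅g, n⁆ * n = g * n * g⁻¹ := by simp [commutatorElement_def]
  rwa [h1, conj_pow, ← commutatorElement_def] at h

/-- The elements commuting with `G` modulo `T` form a subgroup, so `[N ^ n, G] ≤ T` can be checked
on `n`-th powers. -/
theorem commutator_powSubgroup_le {N T : Subgroup G} [T.Normal] {n : ℕ}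
    (h : ∀ y ∈ N, ∀ g : G, ⁅g, y ^ n⁆ ∈ T) : ⁅powSubgroup N n, (⊤ : Subgroup G)⁆ ≤ T := by
  have hc : powSubgroup N n ≤ (Subgroup.center (G ⧸ T)).comap (QuotientGroup.mk' T) := by
    rw [powSubgroup_le_iff]
    intro y hy
    rw [Subgroup.mem_comap, Subgroup.mem_center_iff]
    intro q
    obtain ⟨g, rfl⟩ := QuotientGroup.mk'_surjective T q
    rw [← commutatorElement_eq_one_iff_mul_comm, ← map_commutatorElement]
    exact (QuotientGroup.eq_one_iff _).2 (h y hy g)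
  rw [Subgroup.commutator_le]
  intro u hu g _
  have h1 := Subgroup.mem_center_iff.1 (Subgroup.mem_comap.1 (hc hu)) (QuotientGroup.mk' T g)
  rw [← commutatorElement_eq_one_iff_mul_comm, ← map_commutatorElement] at h1
  rw [← commutatorElement_inv]
  exact inv_mem ((QuotientGroup.eq_one_iff _).1 h1)

end Commutators

/-! ### Uniserial power series -/

/-- A descending series of normal subgroups starting at `G'`, such that `N (i + d)` is the subgroup
generated by the `p`-th powers of `N i`, and whose first `d` factors are central and cyclic, with
`G` acting uniserially on `N 0 / N d`. Centrality and cyclicity of the further factors are not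
required; they follow when `G` is a finite `p`-group and `d < p`. -/
structure IsUniserialPowerSeries {G : Type*} [Group G] (p d : ℕ) (N : ℕ → Subgroup G) : Prop where
  normal : ∀ i, (N i).Normal
  zero : N 0 = commutator G
  antitone : Antitone N
  pow : ∀ i, N (i + d) = powSubgroup (N i) p
  commutator_le : ∀ i < d, ⁅N i, (⊤ : Subgroup G)⁆ ≤ N (i + 1)
  not_commutator_le : ∀ i, i + 1 < d → ¬ ⁅N i, (⊤ : Subgroup G)⁆ ≤ N (i + 2)
  ne : N 0 ≠ N 1
  cyclic : ∀ i < d, ∃ a ∈ N i, N i ≤ Subgroup.zpowers a ⊔ N (i + 1)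

namespace IsUniserialPowerSeries

variable {G : Type*} [Group G] {p d : ℕ} {N : ℕ → Subgroup G}

theorem le_commutator (hN : IsUniserialPowerSeries p d N) (i : ℕ) : N i ≤ commutator G :=
  hN.zero ▸ hN.antitone (Nat.zero_le i)

theorem pow_mem (hN : IsUniserialPowerSeries p d N) {i : ℕ} {z : G} (hz : z ∈ N i) :
    z ^ p ∈ N (i + d) := by
  rw [hN.pow]
  exact pow_mem_powSubgroup hz p

theorem mixedCommutator_le_of_lt {j k : ℕ}
    (h : ∀ i < j + k, ⁅N i, (⊤ : Subgroup G)⁆ ≤ N (i + 1)) :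
    mixedCommutator (N j) ⊤ k ≤ N (j + k) := by
  induction k with
  | zero => exact le_rfl
  | succ k ih =>
    exact (Subgroup.commutator_mono (ih fun i hi => h i (by omega)) le_rfl).trans
      (h (j + k) (by omega))

/-- All factors of the series are central. For the factor `N (j + d) / N (j + d + 1)` the error
terms of the congruence `[g, n ^ p] ≡ [g, n] ^ p` lie deeper than `[N (j + d), G]`, and by
nilpotency they may be neglected. -/
theorem commutator_le_succ [Finite G] [hp : Fact p.Prime] (hG : IsPGroup p G)
    (hN : IsUniserialPowerSeries p d N) (hdp : d < p) (i : ℕ) :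
    ⁅N i, (⊤ : Subgroup G)⁆ ≤ N (i + 1) := by
  have := hN.normal
  have : Group.IsNilpotent G := hG.isNilpotent
  have h2 := hp.out.two_le
  induction i using Nat.strong_induction_on with
  | _ i ih =>
    by_cases hid : i < d
    · exact hN.commutator_le i hid
    obtain ⟨j, rfl⟩ := Nat.exists_eq_add_of_le' (not_lt.1 hid)
    apply le_of_le_sup_commutator_top
    have hd : 0 < d := by
      rcases Nat.eq_zero_or_pos d with rfl | hd
      · have h0 := hN.pow 0
        have h1 : N 0 = ⊥ := eq_bot_of_le_powSubgroup hG h0.le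
        have h3 : N 1 = ⊥ := le_bot_iff.1 (h1 ▸ hN.antitone (Nat.zero_le 1))
        exact absurd (h1.trans h3.symm) hN.ne
      · exact hd
    conv_lhs => rw [hN.pow]
    refine commutator_powSubgroup_le fun n hn g => ?_
    have hgn : ⁅g, n⁆ ∈ N (j + 1) := by
      rw [← commutatorElement_inv]
      exact inv_mem (ih j (by omega) (Subgroup.commutator_mem_commutator hn trivial))
    have hle : N (j + 1) ≤ N j := hN.antitone (Nat.le_succ j)
    have hpow : ∀ z ∈ N (j + 1), z ^ p ∈ N (j + d + 1) := fun z hz => by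
      rw [Nat.add_right_comm]
      exact hN.pow_mem hz
    have key := commutator_pow_prime_mem hp.out
      (T := N (j + d + 1) ⊔ ⁅⁅N (j + d), (⊤ : Subgroup G)⁆, (⊤ : Subgroup G)⁆) hle ?_
      (fun z hz => Subgroup.mem_sup_left (hpow z (Subgroup.commutator_le_left _ _ hz))) hgn hn
    · have := mul_mem key (Subgroup.mem_sup_left (hpow _ hgn))
      simpa using this
    · refine (mixedCommutator_le_of_le_commutator _ _ (hN.le_commutator j) _).trans ?_
      refine (mixedCommutator_antitone _ _ (show d - 1 + 2 ≤ 2 * (p - 1) by omega)).trans ?_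
      refine le_trans ?_ le_sup_right
      refine Subgroup.commutator_mono (Subgroup.commutator_mono ?_ le_rfl) le_rfl
      have := mixedCommutator_le_of_lt (N := N) (j := j + 1) (k := d - 1)
        fun i hi => ih i (by omega)
      rwa [show j + 1 + (d - 1) = j + d by omega] at this

theorem mixedCommutator_top_le [Finite G] [Fact p.Prime] (hG : IsPGroup p G)
    (hN : IsUniserialPowerSeries p d N) (hdp : d < p) (j k : ℕ) :
    mixedCommutator (N j) ⊤ k ≤ N (j + k) :=
  mixedCommutator_le_of_lt fun i _ => hN.commutator_le_succ hG hdp i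

theorem mixedCommutator_le [Finite G] [Fact p.Prime] (hG : IsPGroup p G)
    (hN : IsUniserialPowerSeries p d N) (hdp : d < p) {B : Subgroup G} [B.Normal]
    (hB : B ≤ commutator G) (j k : ℕ) : mixedCommutator (N j) B k ≤ N (j + 2 * k) := by
  have := hN.normal
  exact (mixedCommutator_le_of_le_commutator _ _ hB _).trans (hN.mixedCommutator_top_le hG hdp _ _)

theorem commutator_mem_succ [Finite G] [Fact p.Prime] (hG : IsPGroup p G)
    (hN : IsUniserialPowerSeries p d N) (hdp : d < p) {i : ℕ} {z : G} (hz : z ∈ N i) (g : G) :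
    ⁅g, z⁆ ∈ N (i + 1) := by
  rw [← commutatorElement_inv]
  exact inv_mem (hN.commutator_le_succ hG hdp i (Subgroup.commutator_mem_commutator hz trivial))

/-- The `p`-th power map carries a generator of `N i / N (i + 1)` to a generator of
`N (i + d) / N (i + d + 1)`. -/
theorem le_zpowers_pow_sup [Finite G] [hp : Fact p.Prime] (hG : IsPGroup p G)
    (hN : IsUniserialPowerSeries p d N) (hdp : d < p) {i : ℕ} {a : G} (ha : a ∈ N i)
    (h : N i ≤ Subgroup.zpowers a ⊔ N (i + 1)) :
    N (i + d) ≤ Subgroup.zpowers (a ^ p) ⊔ N (i + d + 1) := by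
  have := hN.normal
  have h2 := hp.out.two_le
  conv_lhs => rw [hN.pow]
  rw [powSubgroup_le_iff]
  intro n hn
  obtain ⟨u, hu, m, hm, rfl⟩ := Subgroup.mem_sup_of_normal_right.1 (h hn)
  have hpow : ∀ z ∈ N (i + 1), z ^ p ∈ N (i + d + 1) := fun z hz => by
    rw [Nat.add_right_comm]
    exact hN.pow_mem hz
  have huN : u ∈ N i := (Subgroup.zpowers_le.2 ha) hu
  have hmN : m ∈ N i := hN.antitone (Nat.le_succ i) hm
  have key := mul_pow_prime_mem_of_normal hp.out (T := N (i + d + 1)) (le_refl (N i))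
    ((hN.mixedCommutator_le hG hdp (hN.le_commutator i) i _).trans (hN.antitone (by omega)))
    (fun z hz => hpow z (hN.commutator_le_succ hG hdp i
      (Subgroup.commutator_mono le_rfl le_top hz))) huN hmN
  obtain ⟨k, rfl⟩ := Subgroup.mem_zpowers_iff.1 hu
  have h3 : (a ^ k) ^ p ∈ Subgroup.zpowers (a ^ p) :=
    Subgroup.mem_zpowers_iff.2 ⟨k, by rw [← zpow_natCast, ← zpow_natCast, zpow_comm]⟩
  have h4 := mul_mem (mul_mem (Subgroup.mem_sup_right (S := Subgroup.zpowers (a ^ p)) key)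
    (Subgroup.mem_sup_left h3)) (Subgroup.mem_sup_right (hpow m hm))
  simpa using h4

theorem exists_le_zpowers_sup [Finite G] [Fact p.Prime] (hG : IsPGroup p G)
    (hN : IsUniserialPowerSeries p d N) (hd : 0 < d) (hdp : d < p) (i : ℕ) :
    ∃ a ∈ N i, N i ≤ Subgroup.zpowers a ⊔ N (i + 1) := by
  induction i using Nat.strong_induction_on with
  | _ i ih =>
    by_cases hid : i < d
    · exact hN.cyclic i hid
    obtain ⟨j, rfl⟩ := Nat.exists_eq_add_of_le' (not_lt.1 hid)
    obtain ⟨a, ha, h⟩ := ih j (by omega)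
    exact ⟨a ^ p, hN.pow_mem ha, hN.le_zpowers_pow_sup hG hdp ha h⟩

/-- Every factor is cyclic of exponent dividing `p`, so any element outside `N (i + 1)` generates
it. -/
theorem le_zpowers_sup [Finite G] [hp : Fact p.Prime] (hG : IsPGroup p G)
    (hN : IsUniserialPowerSeries p d N) (hd : 0 < d) (hdp : d < p) {i : ℕ} {b : G} (hb : b ∈ N i)
    (hb' : b ∉ N (i + 1)) : N i ≤ Subgroup.zpowers b ⊔ N (i + 1) := by
  have := hN.normal
  obtain ⟨a, ha, h⟩ := hN.exists_le_zpowers_sup hG hd hdp i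
  refine h.trans (sup_le ?_ le_sup_right)
  rw [Subgroup.zpowers_le]
  obtain ⟨u, hu, m, hm, rfl⟩ := Subgroup.mem_sup_of_normal_right.1 (h hb)
  obtain ⟨k, rfl⟩ := Subgroup.mem_zpowers_iff.1 hu
  have hap : a ^ (p : ℤ) ∈ N (i + 1) := by
    rw [zpow_natCast]
    exact hN.antitone (by omega) (hN.pow_mem ha)
  have hk : ¬ (p : ℤ) ∣ k := by
    rintro ⟨c, rfl⟩
    refine hb' (mul_mem ?_ hm)
    rw [zpow_mul]
    exact zpow_mem hap c
  obtain ⟨r, s, hrs⟩ :=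
    (Prime.coprime_iff_not_dvd (Nat.prime_iff_prime_int.1 hp.out)).2 hk
  have h1 : a ^ k ∈ Subgroup.zpowers (a ^ k * m) ⊔ N (i + 1) := by
    have := mul_mem (Subgroup.mem_sup_left (T := N (i + 1)) (Subgroup.mem_zpowers (a ^ k * m)))
      (Subgroup.mem_sup_right (inv_mem hm))
    simpa using this
  have h2 : a = (a ^ (p : ℤ)) ^ r * (a ^ k) ^ s := by
    rw [← zpow_mul, ← zpow_mul, ← zpow_add, mul_comm _ r, mul_comm k, hrs, zpow_one]
  have h3 := mul_mem (Subgroup.mem_sup_right (zpow_mem hap r)) (zpow_mem h1 s)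
  rwa [← h2] at h3

/-- If `G` acts trivially on `N i / N (i + 2)`, it acts trivially on
`N (i + d) / N (i + d + 2)`. -/
theorem commutator_le_add_two [Finite G] [hp : Fact p.Prime] (hG : IsPGroup p G)
    (hN : IsUniserialPowerSeries p d N) (hdp : d < p) {i : ℕ}
    (h : ⁅N i, (⊤ : Subgroup G)⁆ ≤ N (i + 2)) :
    ⁅N (i + d), (⊤ : Subgroup G)⁆ ≤ N (i + d + 2) := by
  have := hN.normal
  have h2 := hp.out.two_le
  conv_lhs => rw [hN.pow]
  refine commutator_powSubgroup_le fun n hn g => ?_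
  have hpow : ∀ z ∈ N (i + 2), z ^ p ∈ N (i + d + 2) := fun z hz => by
    rw [Nat.add_right_comm]
    exact hN.pow_mem hz
  have hgn : ⁅g, n⁆ ∈ N (i + 2) := by
    rw [← commutatorElement_inv]
    exact inv_mem (h (Subgroup.commutator_mem_commutator hn trivial))
  have key := commutator_pow_prime_mem hp.out (T := N (i + d + 2))
    (hN.antitone (by omega : i ≤ i + 2))
    ((hN.mixedCommutator_le hG hdp (hN.le_commutator i) (i + 2) _).trans
      (hN.antitone (by omega)))
    (fun z hz => hpow z (Subgroup.commutator_le_left _ _ hz)) hgn hn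
  have := mul_mem key (hpow _ hgn)
  simpa using this

theorem exists_eq_bot [Finite G] [Fact p.Prime] (hG : IsPGroup p G)
    (hN : IsUniserialPowerSeries p d N) : ∃ m, N m = ⊥ := by
  by_contra! hne
  have h : ∀ k, k + Nat.card (N (k * d)) ≤ Nat.card (N 0) := by
    intro k
    induction k with
    | zero => simp
    | succ k ih =>
      have hlt : N ((k + 1) * d) < N (k * d) := by
        rw [Nat.succ_mul, hN.pow]
        exact lt_of_le_not_ge (powSubgroup_le _ _)
          fun hle => hne _ (eq_bot_of_le_powSubgroup hG hle)
      have : Nat.card (N ((k + 1) * d)) < Nat.card (N (k * d)) :=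
        Set.ncard_lt_ncard (SetLike.coe_ssubset_coe.2 hlt)
      omega
  have h1 := h (Nat.card (N 0))
  have h2 : 0 < Nat.card (N (Nat.card (N 0) * d)) := Nat.card_pos
  omega

/-- The commutator `⁅x, h⁆` generating `N i / N (i + 1)` gives `⁅x, h ^ p⁆` generating
`N (i + d) / N (i + d + 1)`. Here `h` is either in the derived subgroup, where commutators count
twice, or arbitrary, where for `d = p - 1` one commutator less is available and has to be
provided by `hh`. -/
theorem commutator_pow_mem_notMem [Finite G] [hp : Fact p.Prime] (hG : IsPGroup p G)
    (hN : IsUniserialPowerSeries p d N) (hd : 0 < d) (hdp : d < p) {i : ℕ}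
    (hne : N (i + d) ≠ N (i + d + 1)) {x h : G} (hx : ⁅x, h⁆ ∈ N i) (hx' : ⁅x, h⁆ ∉ N (i + 1))
    (hh : h ∈ commutator G ∨ ⁅N (i + d - 1), (⊤ : Subgroup G)⁆ ≤ N (i + d + 1)) :
    ⁅x, h ^ p⁆ ∈ N (i + d) ∧ ⁅x, h ^ p⁆ ∉ N (i + d + 1) := by
  have := hN.normal
  have h2 := hp.out.two_le
  have hpow : ∀ z ∈ N (i + 1), z ^ p ∈ N (i + d + 1) := fun z hz => by
    rw [Nat.add_right_comm]
    exact hN.pow_mem hz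
  have hz : ∀ B : Subgroup G, ∀ z ∈ ⁅N i, B⁆, z ^ p ∈ N (i + d + 1) := fun B z hz =>
    hpow z (hN.commutator_le_succ hG hdp i (Subgroup.commutator_mono le_rfl le_top hz))
  have key : ⁅x, h ^ p⁆ * (⁅x, h⁆ ^ p)⁻¹ ∈ N (i + d + 1) := by
    rcases hh with hh | hh
    · exact commutator_pow_prime_mem hp.out (hN.le_commutator i)
        ((hN.mixedCommutator_le hG hdp le_rfl i _).trans (hN.antitone (by omega))) (hz _) hx hh
    · refine commutator_pow_prime_mem hp.out (B := ⊤) le_top ?_ (hz _) hx trivial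
      refine (mixedCommutator_antitone _ _ (show d - 1 + 1 ≤ p - 1 by omega)).trans ?_
      refine le_trans (Subgroup.commutator_mono ?_ le_rfl) hh
      have := hN.mixedCommutator_top_le hG hdp i (d - 1)
      rwa [show i + (d - 1) = i + d - 1 by omega] at this
  have hxp : ⁅x, h⁆ ^ p ∈ N (i + d) := hN.pow_mem hx
  constructor
  · have := mul_mem (hN.antitone (Nat.le_succ _) key) hxp
    simpa using this
  · intro hmem
    have h3 : ⁅x, h⁆ ^ p ∈ N (i + d + 1) := by
      have := mul_mem (inv_mem key) hmem
      rwa [mul_inv_rev, inv_inv, inv_mul_cancel_right] at this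
    have h4 := hN.le_zpowers_pow_sup hG hdp hx (hN.le_zpowers_sup hG hd hdp hx hx')
    exact hne (le_antisymm (h4.trans (sup_le (Subgroup.zpowers_le.2 h3) le_rfl))
      (hN.antitone (Nat.le_succ _)))

/-- A single element `x` has commutators outside `N (j + 1)` in every `N j` with `N j ≠ N (j + 1)`:
for `j < d`, and for `j = d` unless `[N (d - 1), G] ≤ N (d + 1)`, this is a condition on `x` which
excludes one proper subgroup, and further commutators are obtained by taking `p`-th powers. -/
theorem exists_commutator_mem_notMem [Finite G] [Fact p.Prime] (hG : IsPGroup p G)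
    (hN : IsUniserialPowerSeries p d N) (hd : 0 < d) (hdp : d < p) :
    ∃ x : G, ∀ j, N j ≠ N (j + 1) → ∃ h, ⁅x, h⁆ ∈ N j ∧ ⁅x, h⁆ ∉ N (j + 1) := by
  have := hN.normal
  obtain ⟨x, hx⟩ := exists_commutator_notMem hG
    (fun i => Nat.casesOn i (⊤ : Subgroup G) N) (fun i => N (i + 1))
  have hx0 : ∃ h, ⁅x, h⁆ ∉ N 1 := by
    rcases hx 0 (by omega) with h | ⟨h, -, hh⟩
    · have : N 0 ≤ N 1 := hN.zero ▸ h
      exact absurd (le_antisymm this (hN.antitone (Nat.le_succ 0))) hN.ne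
    · exact ⟨h, hh⟩
  have hxs : ∀ i < d, (i + 1 = d ∧ ⁅N i, (⊤ : Subgroup G)⁆ ≤ N (i + 2)) ∨
      ∃ h ∈ N i, ⁅x, h⁆ ∉ N (i + 2) := by
    intro i hi
    rcases hx (i + 1) (by omega) with h | h
    · refine Or.inl ⟨?_, h⟩
      by_contra hne
      exact hN.not_commutator_le i (by omega) h
    · exact Or.inr h
  have key : ∀ j, N j ≠ N (j + 1) → ∃ h, ⁅x, h⁆ ∈ N j ∧ ⁅x, h⁆ ∉ N (j + 1) ∧
      (j = 0 ∨ h ∈ commutator G ∨ ⁅N (j + d - 1), (⊤ : Subgroup G)⁆ ≤ N (j + d + 1)) := by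
    intro j
    induction j using Nat.strong_induction_on with
    | _ j ih =>
      intro hne
      rcases Nat.eq_zero_or_pos j with rfl | hj
      · obtain ⟨h, hh⟩ := hx0
        refine ⟨h, ?_, hh, Or.inl rfl⟩
        rw [hN.zero]
        exact Subgroup.commutator_mem_commutator trivial trivial
      by_cases hex : ∃ h ∈ N (j - 1), ⁅x, h⁆ ∉ N (j + 1)
      · obtain ⟨h, hh, hxh⟩ := hex
        refine ⟨h, ?_, hxh, Or.inr (Or.inl (hN.le_commutator _ hh))⟩
        have := hN.commutator_mem_succ hG hdp hh x
        rwa [show j - 1 + 1 = j by omega] at this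
      -- otherwise `d ≤ j`, and for `j = d` the group acts trivially on `N (d - 1) / N (d + 1)`
      have hjd : d ≤ j ∧ (j = d → ⁅N (d - 1), (⊤ : Subgroup G)⁆ ≤ N (d + 1)) := by
        constructor
        · by_contra hlt
          rcases hxs (j - 1) (by omega) with h | h
          · omega
          · exact hex (by rwa [show j - 1 + 2 = j + 1 by omega] at h)
        · rintro rfl
          rcases hxs (j - 1) (by omega) with h | h
          · rw [show j - 1 + 2 = j + 1 by omega] at h
            exact h.2
          · exact absurd (by rwa [show j - 1 + 2 = j + 1 by omega] at h) hex
      obtain ⟨i, rfl⟩ := Nat.exists_eq_add_of_le' hjd.1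
      have hnei : N i ≠ N (i + 1) := by
        intro he
        apply hne
        rw [Nat.add_right_comm, hN.pow, hN.pow, he]
      obtain ⟨h, hh, hh', hor⟩ := ih i (by omega) hnei
      have hor' : h ∈ commutator G ∨ ⁅N (i + d - 1), (⊤ : Subgroup G)⁆ ≤ N (i + d + 1) := by
        rcases hor with rfl | hor
        · exact Or.inr (by simpa using hjd.2 (by simp))
        · exact hor
      obtain ⟨h1, h2⟩ := hN.commutator_pow_mem_notMem hG hd hdp hne hh hh' hor'
      refine ⟨h ^ p, h1, h2, Or.inr (hor'.imp (fun h => _root_.pow_mem h p) fun hle => ?_)⟩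
      have := hN.commutator_le_add_two hG hdp (i := i + d - 1)
        (by rwa [show i + d - 1 + 2 = i + d + 1 by omega])
      rwa [show i + d - 1 + d = i + d + d - 1 by omega,
        show i + d + d - 1 + 2 = i + d + d + 1 by omega] at this
  exact ⟨x, fun j hj => (key j hj).imp fun h hh => ⟨hh.1, hh.2.1⟩⟩

/-- The commutators with `x` that lie in `N j` cover `N j / N (j + 1)` once one of them is
non-trivial there. -/
theorem exists_commutator_inv_mul_mem [Finite G] [Fact p.Prime] (hG : IsPGroup p G)
    (hN : IsUniserialPowerSeries p d N) (hd : 0 < d) (hdp : d < p) {j : ℕ} {x : G}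
    (hx : N j ≠ N (j + 1) → ∃ h, ⁅x, h⁆ ∈ N j ∧ ⁅x, h⁆ ∉ N (j + 1)) {z : G} (hz : z ∈ N j) :
    ∃ h, ⁅x, h⁆ ∈ N j ∧ ⁅x, h⁆⁻¹ * z ∈ N (j + 1) := by
  have hnormal := hN.normal
  by_cases hne : N j = N (j + 1)
  · exact ⟨1, by simp [one_mem], by simpa [← hne] using hz⟩
  obtain ⟨h, hh, hh'⟩ := hx hne
  have hk : ∀ k : ℕ, (⁅x, h⁆ ^ k)⁻¹ * ⁅x, h ^ k⁆ ∈ N (j + 1) := by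
    intro k
    induction k with
    | zero => simp [one_mem]
    | succ k ih =>
      have h1 := mul_mem ih (hN.commutator_mem_succ hG hdp hh (h ^ k))
      have h2 := (hnormal (j + 1)).conj_mem _ h1 ⁅x, h⁆⁻¹
      rw [pow_succ h, commutatorElement_mul_right_eq_mul_conj, pow_succ ⁅x, h⁆]
      have h3 : (⁅x, h⁆ ^ k * ⁅x, h⁆)⁻¹ * (⁅x, h ^ k⁆ * h ^ k * ⁅x, h⁆ * (h ^ k)⁻¹) =
          ⁅x, h⁆⁻¹ * ((⁅x, h⁆ ^ k)⁻¹ * ⁅x, h ^ k⁆ * ⁅h ^ k, ⁅x, h⁆⁆) * ⁅x, h⁆⁻¹⁻¹ := by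
        rw [commutatorElement_def (h ^ k)]
        group
      rwa [h3]
  obtain ⟨u, hu, m, hm, rfl⟩ :=
    Subgroup.mem_sup_of_normal_right.1 (hN.le_zpowers_sup hG hd hdp hh hh' hz)
  obtain ⟨k, rfl⟩ := (mem_powers_iff_mem_zpowers.2 hu : u ∈ Submonoid.powers ⁅x, h⁆)
  refine ⟨h ^ k, ?_, ?_⟩
  · have := mul_mem (_root_.pow_mem hh k) (hN.antitone (Nat.le_succ j) (hk k))
    simpa using this
  · have := mul_mem (inv_mem (hk k)) hm
    simpa [mul_assoc] using this

/-- Every element of the derived subgroup is a commutator with one fixed element. -/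
theorem exists_forall_mem_commutator [Finite G] [Fact p.Prime] (hG : IsPGroup p G)
    (hN : IsUniserialPowerSeries p d N) (hd : 0 < d) (hdp : d < p) :
    ∃ x : G, ∀ y ∈ commutator G, ∃ g, y = ⁅x, g⁆ := by
  have hnormal := hN.normal
  obtain ⟨x, hx⟩ := hN.exists_commutator_mem_notMem hG hd hdp
  refine ⟨x, fun y hy => ?_⟩
  have key : ∀ m, ∃ g, ⁅x, g⁆⁻¹ * y ∈ N m := by
    intro m
    induction m with
    | zero => exact ⟨1, by simpa [hN.zero] using hy⟩
    | succ m ih =>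
      obtain ⟨g, hg⟩ := ih
      obtain ⟨h, hh, hhz⟩ := hN.exists_commutator_inv_mul_mem hG hd hdp (hx m) hg
      refine ⟨g * h, ?_⟩
      have h1 := (hnormal (m + 1)).conj_mem _
        (inv_mem (hN.commutator_mem_succ hG hdp hh g)) ⁅x, h⁆⁻¹
      have h2 := mul_mem h1 hhz
      rw [commutatorElement_mul_right_eq_mul_conj]
      have h3 : (⁅x, g⁆ * g * ⁅x, h⁆ * g⁻¹)⁻¹ * y =
          ⁅x, h⁆⁻¹ * ⁅g, ⁅x, h⁆⁆⁻¹ * ⁅x, h⁆⁻¹⁻¹ * (⁅x, h⁆⁻¹ * (⁅x, g⁆⁻¹ * y)) := by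
        rw [commutatorElement_def g]
        group
      rwa [h3]
  obtain ⟨m, hm⟩ := hN.exists_eq_bot hG
  obtain ⟨g, hg⟩ := key m
  rw [hm, Subgroup.mem_bot] at hg
  exact ⟨g, (inv_mul_eq_one.1 hg).symm⟩

end IsUniserialPowerSeries

/-! ### Finite `p`-groups with uniserial action modulo the `p`-th powers -/

section Finite

variable {G : Type*} [Group G]

/-- The preimage `[G', G, …, G] (G') ^ p` in `G`, with `i` copies of `G`, of the `i`-th term of the
series whose indices are bounded by the uniseriality assumption. -/
def derivedTerm (G : Type*) [Group G] (p i : ℕ) : Subgroup G :=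
  iteratedCommutator (commutator G) i ⊔ powSubgroup (commutator G) p

instance iteratedCommutator_normal (N : Subgroup G) [N.Normal] (i : ℕ) :
    (iteratedCommutator N i).Normal := by
  induction i with
  | zero => assumption
  | succ i ih => exact Subgroup.commutator_normal _ _

instance derivedTerm_normal (p i : ℕ) : (derivedTerm G p i).Normal :=
  Subgroup.sup_normal _ _

theorem derivedTerm_zero (p : ℕ) : derivedTerm G p 0 = commutator G :=
  sup_eq_left.2 (powSubgroup_le _ _)

theorem derivedTerm_antitone (p : ℕ) : Antitone (derivedTerm G p) :=
  antitone_nat_of_succ_le fun _ => sup_le_sup_right (Subgroup.commutator_le_left _ _) _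

theorem powSubgroup_le_derivedTerm (p i : ℕ) :
    powSubgroup (commutator G) p ≤ derivedTerm G p i :=
  le_sup_right

theorem commutator_derivedTerm_le (p i : ℕ) :
    ⁅derivedTerm G p i, (⊤ : Subgroup G)⁆ ≤ derivedTerm G p (i + 1) := by
  rw [Subgroup.commutator_le]
  intro x hx g _
  obtain ⟨c, hc, m, hm, rfl⟩ := Subgroup.mem_sup_of_normal_right.1 hx
  rw [commutatorElement_mul_left_eq_conj_mul]
  refine mul_mem (Subgroup.mem_sup_right ?_) (Subgroup.mem_sup_left
    (Subgroup.commutator_mem_commutator hc trivial))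
  exact (powSubgroup_normal _ p).conj_mem _
    (Subgroup.commutator_le_left _ ⊤
      (Subgroup.commutator_mem_commutator hm (Subgroup.mem_top g))) _

theorem derivedTerm_succ_le (p i : ℕ) :
    derivedTerm G p (i + 1) ≤
      powSubgroup (commutator G) p ⊔ ⁅derivedTerm G p i, (⊤ : Subgroup G)⁆ :=
  sup_le ((Subgroup.commutator_mono le_sup_left le_rfl).trans le_sup_right) le_sup_left

theorem le_powSubgroup_of_derivedTerm_le_succ [Group.IsNilpotent G] {p i : ℕ}
    (h : derivedTerm G p i ≤ derivedTerm G p (i + 1)) :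
    derivedTerm G p i ≤ powSubgroup (commutator G) p :=
  le_of_le_sup_commutator_top (h.trans (derivedTerm_succ_le p i))

theorem exists_derivedTerm_le [Group.IsNilpotent G] (p : ℕ) :
    ∃ i, derivedTerm G p i ≤ powSubgroup (commutator G) p := by
  obtain ⟨n, hn⟩ := Subgroup.nilpotent_iff_lowerCentralSeries.1 ‹Group.IsNilpotent G›
  have h : ∀ k, iteratedCommutator (commutator G) k ≤ (⊤ : Subgroup G).lowerCentralSeries k := by
    intro k
    induction k with
    | zero => exact le_top
    | succ k ih => exact Subgroup.commutator_mono ih le_rfl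
  exact ⟨n, sup_le ((h n).trans (hn ▸ bot_le)) le_rfl⟩

theorem prime_le_relIndex [Finite G] {p : ℕ} [hp : Fact p.Prime] (hG : IsPGroup p G)
    {H K : Subgroup G} (h : ¬ K ≤ H) : p ≤ H.relIndex K := by
  obtain ⟨n, hn⟩ := IsPGroup.iff_card.1 (hG.to_subgroup K)
  obtain ⟨m, -, hm⟩ := (Nat.dvd_prime_pow hp.out).1 (hn ▸ Subgroup.relIndex_dvd_card H K)
  have hm0 : m ≠ 0 := by
    rintro rfl
    exact h (Subgroup.relIndex_eq_one.1 (by simpa using hm))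
  rw [hm]
  exact Nat.le_self_pow hm0 p

theorem exists_le_zpowers_sup_of_relIndex_le [Finite G] {p : ℕ} [hp : Fact p.Prime]
    (hG : IsPGroup p G) {H K : Subgroup G} (hHK : H ≤ K) (h : H.relIndex K ≤ p) :
    ∃ a ∈ K, K ≤ Subgroup.zpowers a ⊔ H := by
  by_cases hle : K ≤ H
  · exact ⟨1, one_mem K, hle.trans le_sup_right⟩
  obtain ⟨a, ha, haH⟩ := SetLike.not_le_iff_exists.1 hle
  refine ⟨a, ha, ?_⟩
  rw [← Subgroup.relIndex_eq_one]
  have hLK : Subgroup.zpowers a ⊔ H ≤ K := sup_le (Subgroup.zpowers_le.2 ha) hHK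
  have h1 := Subgroup.relIndex_mul_relIndex H (Subgroup.zpowers a ⊔ H) K le_sup_right hLK
  have h2 : p ≤ H.relIndex (Subgroup.zpowers a ⊔ H) :=
    prime_le_relIndex hG fun hle => haH (hle (Subgroup.mem_sup_left (Subgroup.mem_zpowers a)))
  have h3 : (Subgroup.zpowers a ⊔ H).relIndex K ≠ 0 := Subgroup.FiniteIndex.index_ne_zero
  have h4 := hp.out.pos
  by_contra hne
  have h5 : p * 2 ≤ H.relIndex K := h1 ▸ Nat.mul_le_mul h2 (by omega)
  omega

/-- The series which starts with the first `d` terms of `derivedTerm` and is continued by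
`N (i + d) = (N i) ^ p`. -/
def uniserialPowerSeries (G : Type*) [Group G] (p d i : ℕ) : Subgroup G :=
  (fun H => powSubgroup H p)^[i / d] (derivedTerm G p (i % d))

theorem isUniserialPowerSeries_uniserialPowerSeries [Finite G] {p d : ℕ} [Fact p.Prime]
    (hG : IsPGroup p G) (hd : 0 < d)
    (hle : derivedTerm G p d ≤ powSubgroup (commutator G) p)
    (hlt : ∀ i < d, ¬ derivedTerm G p i ≤ powSubgroup (commutator G) p)
    (huni : ∀ i, (derivedTerm G p (i + 1)).relIndex (derivedTerm G p i) ≤ p) :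
    IsUniserialPowerSeries p d (uniserialPowerSeries G p d) := by
  have : Group.IsNilpotent G := hG.isNilpotent
  have hpow : ∀ i, uniserialPowerSeries G p d (i + d) =
      powSubgroup (uniserialPowerSeries G p d i) p := by
    intro i
    rw [uniserialPowerSeries, Nat.add_div_right _ hd, Nat.add_mod_right,
      Function.iterate_succ_apply', uniserialPowerSeries]
  have hlow : ∀ i ≤ d, uniserialPowerSeries G p d i = derivedTerm G p i := by
    have hlow' : ∀ i < d, uniserialPowerSeries G p d i = derivedTerm G p i := by
      intro i hi
      rw [uniserialPowerSeries, Nat.div_eq_of_lt hi, Nat.mod_eq_of_lt hi,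
        Function.iterate_zero_apply]
    intro i hi
    rcases hi.lt_or_eq with hi | rfl
    · exact hlow' i hi
    · have := hpow 0
      rw [zero_add, hlow' 0 hd, derivedTerm_zero] at this
      rw [this]
      exact le_antisymm (powSubgroup_le_derivedTerm p i) hle
  have hstrict : ∀ i < d, ¬ derivedTerm G p i ≤ derivedTerm G p (i + 1) :=
    fun i hi h => hlt i hi (le_powSubgroup_of_derivedTerm_le_succ h)
  refine ⟨fun i => ?_, ?_, antitone_nat_of_succ_le fun i => ?_, hpow, fun i hi => ?_,
    fun i hi => ?_, ?_, fun i hi => ?_⟩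
  · unfold uniserialPowerSeries
    induction i / d with
    | zero => exact derivedTerm_normal _ _
    | succ k ih =>
      rw [Function.iterate_succ_apply']
      exact powSubgroup_normal _ p
  · rw [hlow 0 hd.le, derivedTerm_zero]
  · induction i using Nat.strong_induction_on with
    | _ i ih =>
      by_cases hid : i < d
      · rw [hlow i hid.le, hlow (i + 1) hid]
        exact derivedTerm_antitone p (Nat.le_succ i)
      obtain ⟨j, rfl⟩ := Nat.exists_eq_add_of_le' (not_lt.1 hid)
      rw [Nat.add_right_comm, hpow, hpow]
      exact powSubgroup_mono (ih j (by omega)) p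
  · rw [hlow i hi.le, hlow (i + 1) hi]
    exact commutator_derivedTerm_le p i
  · rw [hlow i (by omega), hlow (i + 2) hi]
    intro h
    exact hstrict (i + 1) hi
      ((derivedTerm_succ_le p i).trans (sup_le (powSubgroup_le_derivedTerm p _) h))
  · rw [hlow 0 hd.le, hlow 1 hd]
    exact fun h => hstrict 0 hd h.le
  · rw [hlow i hi.le, hlow (i + 1) hi]
    exact exists_le_zpowers_sup_of_relIndex_le hG (derivedTerm_antitone p (Nat.le_succ i)) (huni i)

/-- In a finite `p`-group satisfying the assumptions, `G'` consists of commutators with one `x`. The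
assumptions on indices are upper bounds, so that they pass to quotients; the length `e ≤ d` of the
series from `G'` to `(G') ^ p` takes the role of `d`. -/
theorem exists_forall_mem_commutator_of_finite [Finite G] {p d : ℕ} [hp : Fact p.Prime]
    (hG : IsPGroup p G) (hd : (powSubgroup (commutator G) p).relIndex (commutator G) ≤ p ^ d)
    (hdp : d < p)
    (huni : ∀ i, (derivedTerm G p (i + 1)).relIndex (derivedTerm G p i) ≤ p) :
    ∃ x : G, ∀ y ∈ commutator G, ∃ g, y = ⁅x, g⁆ := by
  classical
  have : Group.IsNilpotent G := hG.isNilpotent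
  have hex := exists_derivedTerm_le (G := G) p
  have hle := Nat.find_spec hex
  have hlt := fun i => Nat.find_min hex (m := i)
  generalize Nat.find hex = e at hle hlt
  rcases Nat.eq_zero_or_pos e with rfl | he
  · rw [derivedTerm_zero] at hle
    have hbot := eq_bot_of_le_powSubgroup hG hle
    refine ⟨1, fun y hy => ⟨1, ?_⟩⟩
    rw [hbot, Subgroup.mem_bot] at hy
    simp [hy]
  refine (isUniserialPowerSeries_uniserialPowerSeries hG he hle
    (fun i hi => hlt i hi) huni).exists_forall_mem_commutator hG he ?_
  have hidx : ∀ i ≤ e, p ^ i ≤ (derivedTerm G p i).relIndex (commutator G) := by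
    intro i hi
    induction i with
    | zero =>
      rw [pow_zero]
      exact Nat.one_le_iff_ne_zero.2 Subgroup.FiniteIndex.index_ne_zero
    | succ i ih =>
      have h1 := derivedTerm_antitone (G := G) p (Nat.le_succ i)
      have h2 : derivedTerm G p i ≤ commutator G :=
        derivedTerm_zero (G := G) p ▸ derivedTerm_antitone p (Nat.zero_le i)
      rw [← Subgroup.relIndex_mul_relIndex _ _ _ h1 h2, pow_succ, mul_comm]
      refine Nat.mul_le_mul (prime_le_relIndex hG fun h => ?_) (ih (by omega))
      exact hlt i hi (le_powSubgroup_of_derivedTerm_le_succ h)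
  have h1 := hidx e le_rfl
  rw [le_antisymm hle (powSubgroup_le_derivedTerm p e)] at h1
  exact ((Nat.pow_le_pow_iff_right hp.out.one_lt).1 (h1.trans hd)).trans_lt hdp

end Finite

/-! ### Quotients and the passage to the limit -/

section Limit

variable {G Q : Type*} [Group G] [Group Q]

theorem map_commutator_top_of_surjective {f : G →* Q} (hf : Function.Surjective f) :
    (commutator G).map f = commutator Q := by
  rw [commutator_def, commutator_def, Subgroup.map_commutator, Subgroup.map_top_of_surjective f hf]

theorem map_iteratedCommutator {f : G →* Q} (hf : Function.Surjective f) (N : Subgroup G) (i : ℕ) :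
    (iteratedCommutator N i).map f = iteratedCommutator (N.map f) i := by
  induction i with
  | zero => rfl
  | succ i ih =>
    rw [iteratedCommutator, iteratedCommutator, Subgroup.map_commutator, ih,
      Subgroup.map_top_of_surjective f hf]

theorem map_derivedTerm {f : G →* Q} (hf : Function.Surjective f) (p i : ℕ) :
    (derivedTerm G p i).map f = derivedTerm Q p i := by
  rw [derivedTerm, Subgroup.map_sup, map_iteratedCommutator hf, map_powSubgroup,
    map_commutator_top_of_surjective hf, derivedTerm]

theorem relIndex_map_dvd (f : G →* Q) (H K : Subgroup G) :
    (H.map f).relIndex (K.map f) ∣ H.relIndex K := by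
  rw [← Subgroup.relIndex_comap]
  exact Subgroup.relIndex_dvd_of_le_left K (Subgroup.le_comap_map f H)

/-- A statement about commutators that holds in all finite continuous quotients of a profinite
group holds in the group, by compactness: the sets of suitable `x` are closed and form an inverse
system, and so do, for a fixed `x`, the sets of suitable `g`. -/
theorem exists_forall_mem_commutator_of_quotients [TopologicalSpace G] [IsTopologicalGroup G]
    [CompactSpace G] [T2Space G] [TotallyDisconnectedSpace G]
    (h : ∀ U : OpenNormalSubgroup G, ∃ x : G ⧸ (U : Subgroup G),
      ∀ y ∈ commutator (G ⧸ (U : Subgroup G)), ∃ g, y = ⁅x, g⁆) :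
    ∃ x : G, ∀ y ∈ commutator G, ∃ g, y = ⁅x, g⁆ := by
  have hmem : ∀ (U : OpenNormalSubgroup G) (x y g : G),
      ((y : G ⧸ (U : Subgroup G)) = ⁅(x : G ⧸ (U : Subgroup G)), (g : G ⧸ (U : Subgroup G))⁆) ↔
        ⁅x, g⁆⁻¹ * y ∈ U := by
    intro U x y g
    rw [eq_comm]
    exact QuotientGroup.eq (s := (U : Subgroup G)) (a := ⁅x, g⁆) (b := y)
  have hclopen : ∀ U : OpenNormalSubgroup G, IsClosed (U : Set G) := fun U =>
    U.toOpenSubgroup.isClosed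
  have : Nonempty (OpenNormalSubgroup G) := 
    ⟨{ toOpenSubgroup := ⊤, isNormal' := inferInstanceAs (⊤ : Subgroup G).Normal }⟩
  let X : OpenNormalSubgroup G → Set G := fun U =>
    {x | ∀ y ∈ commutator G, ∃ g, ⁅x, g⁆⁻¹ * y ∈ U}
  have hX : (⋂ U, X U).Nonempty := by
    have hXc : ∀ U, IsClosed (X U) := by
      intro U
      have : DiscreteTopology (G ⧸ (U : Subgroup G)) :=
        QuotientGroup.discreteTopology U.toOpenSubgroup.isOpen
      have hpre : X U = (QuotientGroup.mk : G → G ⧸ (U : Subgroup G)) ⁻¹'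
          {q | ∀ y ∈ commutator G, ∃ g : G, (y : G ⧸ (U : Subgroup G)) = ⁅q, (g : G ⧸ _)⁆} := by
        ext x
        simp only [X, Set.mem_ofPred_eq, Set.mem_preimage, hmem]
      rw [hpre]
      exact (isClosed_discrete _).preimage QuotientGroup.continuous_mk
    refine IsCompact.nonempty_iInter_of_directed_nonempty_isCompact_isClosed X ?_ ?_
      (fun U => (hXc U).isCompact) hXc
    · intro U V
      refine ⟨U ⊓ V, fun x hx y hy => ?_, fun x hx y hy => ?_⟩
      · exact (hx y hy).imp fun g hg => (inf_le_left : U ⊓ V ≤ U) hg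
      · exact (hx y hy).imp fun g hg => (inf_le_right : U ⊓ V ≤ V) hg
    · intro U
      obtain ⟨q, hq⟩ := h U
      obtain ⟨x, rfl⟩ := QuotientGroup.mk_surjective q
      refine ⟨x, fun y hy => ?_⟩
      obtain ⟨r, hr⟩ := hq y (by
        rw [← map_commutator_top_of_surjective (QuotientGroup.mk'_surjective (U : Subgroup G))]
        exact Subgroup.mem_map_of_mem _ hy)
      obtain ⟨g, rfl⟩ := QuotientGroup.mk_surjective r
      exact ⟨g, (hmem U x y g).1 hr⟩
  obtain ⟨x, hx⟩ := hX
  rw [Set.mem_iInter] at hx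
  refine ⟨x, fun y hy => ?_⟩
  let C : OpenNormalSubgroup G → Set G := fun U => {g | ⁅x, g⁆⁻¹ * y ∈ U}
  have hC : (⋂ U, C U).Nonempty := by
    have hCc : ∀ U, IsClosed (C U) := by
      intro U
      have hcont : Continuous fun g : G => ⁅x, g⁆⁻¹ * y := by
        simp only [commutatorElement_def]
        fun_prop
      exact (hclopen U).preimage hcont
    refine IsCompact.nonempty_iInter_of_directed_nonempty_isCompact_isClosed C ?_
      (fun U => hx U y hy) (fun U => (hCc U).isCompact) hCc
    intro U V
    exact ⟨U ⊓ V, fun g hg => (inf_le_left : U ⊓ V ≤ U) hg,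
      fun g hg => (inf_le_right : U ⊓ V ≤ V) hg⟩
  obtain ⟨g, hg⟩ := hC
  rw [Set.mem_iInter] at hg
  refine ⟨g, ?_⟩
  by_contra hne
  have hne' : (1 : G) ∈ ({⁅x, g⁆⁻¹ * y}ᶜ : Set G) := by
    rw [Set.mem_compl_singleton_iff]
    exact fun h1 => hne (inv_mul_eq_one.1 h1.symm).symm
  obtain ⟨U, hU⟩ := ProfiniteGrp.exist_openNormalSubgroup_sub_open_nhds_of_one
    isOpen_compl_singleton hne'
  exact hU (hg U) rfl

end Limit

theorem theoremB {G : Type*} [Group G] [TopologicalSpace G] (p : ℕ) (hp : p.Prime)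
    (hG : IsProPGroup p G)
    (hfg : IsTopologicallyFG (commutator G))
    (d : ℕ) (hd : (powSubgroup (commutator G) p).relIndex (commutator G) = p ^ d)
    (hdp : d ≤ p - 1)
    (huni : ActsUniseriallyModulo p (commutator G) (powSubgroup (commutator G) p)) :
    ∃ x : G, (commutator G : Set G) = {y : G | ∃ g : G, y = ⁅x, g⁆} := by
  have := Fact.mk hp
  have := hG.isTopologicalGroup
  have := hG.compactSpace
  have := hG.t2Space
  have := hG.totallyDisconnectedSpace
  have hp0 := hp.pos
  have huni' : ∀ i, (derivedTerm G p (i + 1)).relIndex (derivedTerm G p i) ≠ 0 ∧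
      (derivedTerm G p (i + 1)).relIndex (derivedTerm G p i) ≤ p := by
    intro i
    have h := huni i
    rwa [← map_iteratedCommutator (QuotientGroup.mk'_surjective _),
      ← map_iteratedCommutator (QuotientGroup.mk'_surjective _), Subgroup.relIndex_map_map,
      QuotientGroup.ker_mk'] at h
  obtain ⟨x, hx⟩ := exists_forall_mem_commutator_of_quotients (G := G) fun U => by
    have hf := QuotientGroup.mk'_surjective (U : Subgroup G)
    obtain ⟨n, hn⟩ := hG.index_eq_pow (U : Subgroup G) inferInstance U.toOpenSubgroup.isOpen
    have hcard : Nat.card (G ⧸ (U : Subgroup G)) = p ^ n := hn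
    have : Finite (G ⧸ (U : Subgroup G)) :=
      Nat.finite_of_card_ne_zero (hcard ▸ pow_ne_zero n hp.ne_zero)
    refine exists_forall_mem_commutator_of_finite (d := d) (IsPGroup.of_card hcard) ?_
      (by omega) fun i => ?_
    · rw [← map_commutator_top_of_surjective hf, ← map_powSubgroup, ← hd]
      refine Nat.le_of_dvd ?_ (relIndex_map_dvd _ _ _)
      rw [hd]
      exact pow_pos hp.pos d
    · rw [← map_derivedTerm hf, ← map_derivedTerm hf]
      exact (Nat.le_of_dvd (Nat.pos_of_ne_zero (huni' i).1)
        (relIndex_map_dvd _ _ _)).trans (huni' i).2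
  refine ⟨x, Set.Subset.antisymm (fun y hy => hx y hy) ?_⟩
  rintro _ ⟨g, rfl⟩
  exact Subgroup.commutator_mem_commutator trivial trivial
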